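/- Let $G$ be a totally disconnected, locally compact topological group, and let $\alpha : G \to G$ be an endomorphism, that is, a continuous homomorphism. For every compact open subgroup $U \le G$ and every $n \ge 0$ the index $[\alpha^n(U) : U \cap \alpha^n(U)]$ is finite, where $\alpha^n$ denotes the $n$-fold composition of $\alpha$ with itself. The scale of $\alpha$ is the positive integer $$s(\alpha) := \min\{[\alpha(U) : U \cap \alpha(U)] \mid U \le G \text{ is a compact open subgroup}\}.$$ Then, for every endomorphism $\alpha$ of $G$ and every compact open subgroup $V$ of $G$, $$s(\alpha) = \lim_{n\to\infty} [\alpha^n(V) : V \cap \alpha^n(V)]^{1/n}.$$ -/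

import Mathlib

open Filter Topology

/-- The displacement index `[α(U) : U ∩ α(U)]` of a subgroup `U` under an endomorphism `α`.
`Subgroup.relIndex` is `0` when the index is infinite; for `α` continuous and `U` compact and open
the index is finite, see `displacementIndex_ne_zero`. -/
noncomputable def displacementIndex {G : Type*} [Group G] (α : Monoid.End G) (U : Subgroup G) : ℕ :=
  (U ⊓ Subgroup.map α U).relIndex (Subgroup.map α U)

/-- The set of displacement indices of the compact open subgroups of `G` under `α`. -/
def displacementIndices {G : Type*} [Group G] [TopologicalSpace G] (α : Monoid.End G) : Set ℕ :=
  {m | ∃ U : Subgroup G,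
    IsCompact (U : Set G) ∧ IsOpen (U : Set G) ∧ displacementIndex α U = m}

/-- The scale of `α`: the minimum of the displacement indices of the compact open subgroups.
For continuous `α` on a totally disconnected locally compact group this is a minimum that is
attained and positive, see `scale_isLeast` and `scale_pos`. -/
noncomputable def scale {G : Type*} [Group G] [TopologicalSpace G] (α : Monoid.End G) : ℕ :=
  sInf (displacementIndices α)

theorem displacementIndex_ne_zero {G : Type*} [Group G] [TopologicalSpace G]
    [IsTopologicalGroup G] (α : Monoid.End G) (hα : Continuous α) (U : Subgroup G)
    (hc : IsCompact (U : Set G)) (ho : IsOpen (U : Set G)) : displacementIndex α U ≠ 0 := by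
  have hK : IsCompact ((Subgroup.map α U : Subgroup G) : Set G) := hc.image hα
  have : CompactSpace (Subgroup.map α U) := isCompact_iff_compactSpace.mp hK
  rw [displacementIndex, Subgroup.inf_relIndex_right, Subgroup.relIndex]
  have hopen : IsOpen ((U.subgroupOf (Subgroup.map α U) : Subgroup (Subgroup.map α U)) :
      Set (Subgroup.map α U)) := ho.preimage continuous_subtype_val
  have := Subgroup.quotient_finite_of_isOpen _ hopen
  exact Subgroup.index_ne_zero_of_finite (H := U.subgroupOf (Subgroup.map α U))

theorem exists_compact_open_subgroup (G : Type*) [Group G] [TopologicalSpace G]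
    [IsTopologicalGroup G] [LocallyCompactSpace G] [TotallyDisconnectedSpace G] :
    ∃ U : Subgroup G, IsCompact (U : Set G) ∧ IsOpen (U : Set G) := by
  obtain ⟨K, hK, h1⟩ := exists_compact_mem_nhds (1 : G)
  obtain ⟨W, hW, h1W, hWK⟩ :=
    (loc_compact_Haus_tot_disc_of_zero_dim (H := G)).mem_nhds_iff.mp h1
  have hWc : IsCompact W := hK.of_isClosed_subset hW.isClosed hWK
  have key : ∀ᶠ g in 𝓝 (1 : G), ∀ w ∈ W, g * w ∈ W := by
    refine hWc.eventually_forall_of_forall_eventually fun w hw => ?_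
    have hcont : ContinuousAt (fun p : G × G => p.1 * p.2) (1, w) := continuous_mul.continuousAt
    exact hcont.eventually (hW.isOpen.mem_nhds (by simpa using hw))
  have key' : ∀ᶠ g in 𝓝 (1 : G), ∀ w ∈ W, g⁻¹ * w ∈ W := by
    have hinv : Tendsto (fun g : G => g⁻¹) (𝓝 1) (𝓝 1) := by
      simpa using (continuous_inv.tendsto (1 : G))
    exact hinv.eventually key
  let H : Subgroup G :=
    { carrier := {g | (∀ w ∈ W, g * w ∈ W) ∧ ∀ w ∈ W, g⁻¹ * w ∈ W}
      one_mem' := by simp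
      mul_mem' := by
        rintro a b ⟨ha, ha'⟩ ⟨hb, hb'⟩
        refine ⟨fun w hw => ?_, fun w hw => ?_⟩
        · rw [mul_assoc]; exact ha _ (hb _ hw)
        · rw [mul_inv_rev, mul_assoc]; exact hb' _ (ha' _ hw)
      inv_mem' := by
        rintro a ⟨ha, ha'⟩
        exact ⟨ha', by simpa using ha⟩ }
  have hH : IsOpen (H : Set G) := H.isOpen_of_mem_nhds (g := 1) (key.and key')
  refine ⟨H, hWc.of_isClosed_subset (H.isClosed_of_isOpen hH) fun g hg => ?_, hH⟩
  simpa using hg.1 1 h1W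

/-- The scale is attained: it is the least displacement index. -/
theorem scale_isLeast {G : Type*} [Group G] [TopologicalSpace G] [IsTopologicalGroup G]
    [LocallyCompactSpace G] [TotallyDisconnectedSpace G] (α : Monoid.End G) :
    IsLeast (displacementIndices α) (scale α) := by
  obtain ⟨U, hc, ho⟩ := exists_compact_open_subgroup G
  exact ⟨Nat.sInf_mem ⟨_, U, hc, ho, rfl⟩, fun m hm => Nat.sInf_le hm⟩

theorem scale_pos {G : Type*} [Group G] [TopologicalSpace G] [IsTopologicalGroup G]
    [LocallyCompactSpace G] [TotallyDisconnectedSpace G] (α : Monoid.End G)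
    (hα : Continuous α) : 0 < scale α := by
  obtain ⟨U, hc, ho, h⟩ := (scale_isLeast α).1
  exact h ▸ Nat.pos_of_ne_zero (displacementIndex_ne_zero α hα U hc ho)

/-! Write `U₊` for the elements of `U` with infinite backward `α`-trajectories in `U` and `U₋` for
those whose forward orbit stays in `U`. Call `U` tidy if `U = U₊U₋` and `U` contains the homoclinic
subgroup `⋃ αᵐ(U₊) ∩ ⋃ α⁻ⁿ(U₋)`. For tidy `U` the index `[αⁿ(U) : U ∩ αⁿ(U)]` equals
`[αⁿ(U₊) : U₊]`, and in the tower `U₊ ≤ α(U₊) ≤ α²(U₊) ≤ ⋯` every step has the same index because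
the kernels of the iterates do not interfere; hence `[αⁿ(U) : U ∩ αⁿ(U)] = [α(U) : U ∩ α(U)]ⁿ`.

Tidy subgroups exist: the closure `L` of the homoclinic subgroup of a compact open `U` is compact
and satisfies `α(L) = L`. Shrink `U` to a compact open subgroup normalized by `L`, pass to the
elements whose first few iterates stay in it to get a subgroup `Y = Y₊Y₋`, still normalized by `L`,
and take `YL`.

For two compact open subgroups the displacement indices under any endomorphism differ by a bounded
factor, so the `n`-th roots have the same limit, namely `[α(W) : W ∩ α(W)]` for `W` tidy. Since
displacement indices are submultiplicative, this limit is at most `[α(U) : U ∩ α(U)]` for every `U`,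
so it is the scale. -/

open scoped Pointwise

section Iterates

theorem end_pow_add_apply {M : Type*} [MulOneClass M] (α : Monoid.End M) (m n : ℕ) (x : M) :
    (α ^ (m + n)) x = (α ^ m) ((α ^ n) x) := by
  rw [pow_add]; rfl

theorem end_pow_succ_apply {M : Type*} [MulOneClass M] (α : Monoid.End M) (n : ℕ) (x : M) :
    (α ^ (n + 1)) x = (α ^ n) (α x) := by
  rw [pow_succ]; rfl

theorem end_pow_succ_apply' {M : Type*} [MulOneClass M] (α : Monoid.End M) (n : ℕ) (x : M) :
    (α ^ (n + 1)) x = α ((α ^ n) x) := by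
  rw [pow_succ']; rfl

theorem continuous_end_pow {M : Type*} [MulOneClass M] [TopologicalSpace M] {α : Monoid.End M}
    (hα : Continuous α) (n : ℕ) : Continuous (α ^ n) := by
  rw [Monoid.End.coe_pow]; exact hα.iterate n

variable {G : Type*} [Group G] {α : Monoid.End G} {H : Subgroup G}

theorem map_end_pow_zero (α : Monoid.End G) (H : Subgroup G) : H.map (α ^ 0) = H :=
  H.map_id

theorem map_end_pow_one (α : Monoid.End G) (H : Subgroup G) : H.map (α ^ 1) = H.map α :=
  congrArg (fun β : Monoid.End G => H.map β) (pow_one α)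

theorem map_end_pow_add (α : Monoid.End G) (H : Subgroup G) (m n : ℕ) :
    H.map (α ^ (m + n)) = (H.map (α ^ n)).map (α ^ m) := by
  rw [pow_add]; exact (H.map_map (α ^ m) (α ^ n)).symm

theorem map_end_pow_succ (α : Monoid.End G) (H : Subgroup G) (n : ℕ) :
    H.map (α ^ (n + 1)) = (H.map α).map (α ^ n) := by
  rw [pow_succ]; exact (H.map_map (α ^ n) α).symm

theorem monotone_map_end_pow (h : H ≤ H.map α) : Monotone fun n : ℕ => H.map (α ^ n) := by
  refine monotone_nat_of_le_succ fun n => ?_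
  rw [map_end_pow_succ]
  exact Subgroup.map_mono h

theorem le_map_end_pow (h : H ≤ H.map α) (n : ℕ) : H ≤ H.map (α ^ n) :=
  (map_end_pow_zero α H).ge.trans (monotone_map_end_pow h n.zero_le)

theorem end_pow_mem_of_map_le (h : H.map α ≤ H) (n : ℕ) {x : G} (hx : x ∈ H) :
    (α ^ n) x ∈ H := by
  induction n with
  | zero => exact hx
  | succ n ih =>
    rw [end_pow_succ_apply']
    exact h (Subgroup.mem_map_of_mem α ih)

theorem map_end_pow_eq_self (h : H.map α = H) (n : ℕ) : H.map (α ^ n) = H := by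
  induction n with
  | zero => exact map_end_pow_zero α H
  | succ n ih => rw [map_end_pow_succ, h, ih]

end Iterates

section RelIndex

variable {G : Type*} [Group G] {H K L : Subgroup G}

theorem relIndex_eq_of_subset_mul (hLK : L ≤ K) (h : (K : Set G) ⊆ (L : Set G) * (H : Set G)) :
    H.relIndex K = H.relIndex L := by
  let ι := Subgroup.quotientSubgroupOfEmbeddingOfLE H hLK
  have hι : Function.Surjective ι := fun q => by
    induction q using QuotientGroup.induction_on with
    | H k =>
      obtain ⟨l, hl, y, hy, hk⟩ := h k.2
      refine ⟨QuotientGroup.mk ⟨l, hl⟩, QuotientGroup.eq.mpr (Subgroup.mem_subgroupOf.mpr ?_)⟩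
      change l⁻¹ * (k : G) ∈ H
      rwa [← hk, inv_mul_cancel_left]
  exact (Nat.card_congr (Equiv.ofBijective ι ⟨ι.injective, hι⟩)).symm

theorem relIndex_map_map_eq_of_ker_inf_le {G' : Type*} [Group G'] (f : G →* G') (hHK : H ≤ K)
    (h : f.ker ⊓ K ≤ H) : (H.map f).relIndex (K.map f) = H.relIndex K := by
  suffices (H.map f).comap f ⊓ K = H by
    rw [← Subgroup.relIndex_comap, ← Subgroup.inf_relIndex_right, this]
  refine le_antisymm ?_ (le_inf (Subgroup.le_comap_map f H) hHK)
  rintro x ⟨⟨y, hy, hyx⟩, hxK⟩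
  have hker : y⁻¹ * x ∈ f.ker := by
    rw [MonoidHom.mem_ker, map_mul, map_inv, hyx, inv_mul_cancel]
  simpa using H.mul_mem hy (h ⟨hker, K.mul_mem (K.inv_mem (hHK hy)) hxK⟩)

theorem relIndex_map_map_dvd {G' : Type*} [Group G'] (f : G →* G') (H K : Subgroup G) :
    (H.map f).relIndex (K.map f) ∣ H.relIndex K := by
  rw [← Subgroup.relIndex_comap]
  exact Subgroup.relIndex_dvd_of_le_left K (Subgroup.le_comap_map f H)

theorem relIndex_le_relIndex_mul_relIndex (hKL : K ≤ L) (hne : K.relIndex L ≠ 0) :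
    H.relIndex L ≤ H.relIndex K * K.relIndex L := by
  by_cases hHL : H.relIndex L = 0
  · simp only [hHL, Nat.zero_le]
  have hHK : H.relIndex K ≠ 0 := fun h => hHL (Subgroup.relIndex_eq_zero_of_le_right hKL h)
  have hmul := Subgroup.relIndex_inf_mul_relIndex H K L
  rw [inf_of_le_left hKL] at hmul
  rw [hmul]
  exact Subgroup.relIndex_le_of_le_left inf_le_left (hmul ▸ mul_ne_zero hHK hne)

theorem relIndex_ne_zero_of_isOpen_of_isCompact [TopologicalSpace G] [IsTopologicalGroup G]
    (hH : IsOpen (H : Set G)) (hK : IsCompact (K : Set G)) : H.relIndex K ≠ 0 := by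
  have : CompactSpace K := isCompact_iff_compactSpace.mp hK
  have := Subgroup.quotient_finite_of_isOpen (H.subgroupOf K) (hH.preimage continuous_subtype_val)
  exact Subgroup.index_ne_zero_of_finite (H := H.subgroupOf K)

theorem relIndex_map_end_pow {α : Monoid.End G} (hH : H ≤ H.map α)
    (hker : ∀ n, (α ^ n).ker ⊓ H.map α ≤ H) (n : ℕ) :
    H.relIndex (H.map (α ^ n)) = H.relIndex (H.map α) ^ n := by
  induction n with
  | zero => exact (congrArg H.relIndex (map_end_pow_zero α H)).trans (H.relIndex_self)
  | succ n ih =>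
    have hstep : (H.map (α ^ n)).relIndex (H.map (α ^ (n + 1))) = H.relIndex (H.map α) := by
      rw [map_end_pow_succ]
      exact relIndex_map_map_eq_of_ker_inf_le (α ^ n) hH (hker n)
    calc H.relIndex (H.map (α ^ (n + 1)))
        = H.relIndex (H.map (α ^ n)) * (H.map (α ^ n)).relIndex (H.map (α ^ (n + 1))) :=
          (Subgroup.relIndex_mul_relIndex H _ _ (le_map_end_pow hH n)
            (monotone_map_end_pow hH n.le_succ)).symm
      _ = H.relIndex (H.map α) ^ (n + 1) := by rw [ih, hstep, pow_succ]

theorem exists_subset_mul_of_relIndex_ne_zero (hfin : H.relIndex K ≠ 0) {A : ℕ → Subgroup G}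
    (hA : Monotone A) (hK : ∀ x ∈ K, ∃ n, x ∈ A n) :
    ∃ N, (K : Set G) ⊆ ((H ⊓ K : Subgroup G) : Set G) * ((K ⊓ A N : Subgroup G) : Set G) := by
  have : Finite (K ⧸ H.subgroupOf K) := Nat.finite_of_card_ne_zero hfin
  choose f hf using fun q : K ⧸ H.subgroupOf K => hK _ q.out.2
  obtain ⟨N, hN⟩ := (Set.finite_range f).bddAbove
  refine ⟨N, fun x hx => ?_⟩
  set q : K ⧸ H.subgroupOf K := QuotientGroup.mk (⟨x, hx⟩⁻¹ : K)
  have hxq : x * (q.out : G) ∈ H := by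
    simpa [Subgroup.mem_subgroupOf] using QuotientGroup.eq.mp q.out_eq'.symm
  exact ⟨x * q.out, ⟨hxq, K.mul_mem hx q.out.2⟩, (q.out : G)⁻¹,
    ⟨K.inv_mem q.out.2, (A N).inv_mem (hA (hN ⟨q, rfl⟩) (hf q))⟩, mul_inv_cancel_right _ _⟩

end RelIndex

section DisplacementIndex

variable {G : Type*} [Group G] {V W : Subgroup G}

theorem displacementIndex_eq_relIndex (β : Monoid.End G) (U : Subgroup G) :
    displacementIndex β U = U.relIndex (U.map β) :=
  Subgroup.inf_relIndex_right _ _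

theorem displacementIndex_mul_le {β α : Monoid.End G} (hβ : displacementIndex β W ≠ 0)
    (hα : displacementIndex α W ≠ 0) :
    displacementIndex (β * α) W ≤ displacementIndex β W * displacementIndex α W := by
  have hdvd : ((W ⊓ W.map α).map β).relIndex ((W.map α).map β) ∣ displacementIndex α W :=
    relIndex_map_map_dvd β _ _
  rw [displacementIndex_eq_relIndex] at hβ
  calc displacementIndex (β * α) W = W.relIndex ((W.map α).map β) :=
        (displacementIndex_eq_relIndex _ W).trans (congrArg W.relIndex (W.map_map β α).symm)
    _ ≤ W.relIndex ((W ⊓ W.map α).map β) *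
          ((W ⊓ W.map α).map β).relIndex ((W.map α).map β) :=
        relIndex_le_relIndex_mul_relIndex (Subgroup.map_mono inf_le_right)
          (ne_zero_of_dvd_ne_zero hα hdvd)
    _ ≤ W.relIndex (W.map β) * displacementIndex α W :=
        Nat.mul_le_mul
          (Subgroup.relIndex_le_of_le_right (Subgroup.map_mono inf_le_left) hβ)
          (Nat.le_of_dvd (Nat.pos_of_ne_zero hα) hdvd)
    _ = displacementIndex β W * displacementIndex α W := by
        rw [displacementIndex_eq_relIndex β]

theorem displacementIndex_le_of_le {β : Monoid.End G} (hWV : W ≤ V) (hV : W.relIndex V ≠ 0)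
    (hβ : displacementIndex β V ≠ 0) :
    displacementIndex β W ≤ W.relIndex V * displacementIndex β V := by
  rw [displacementIndex_eq_relIndex] at hβ ⊢
  rw [displacementIndex_eq_relIndex]
  calc W.relIndex (W.map β) ≤ W.relIndex (V.map β) :=
        Subgroup.relIndex_le_of_le_right (Subgroup.map_mono hWV)
          (Subgroup.relIndex_ne_zero_trans hV hβ)
    _ = W.relIndex (V ⊓ V.map β) * V.relIndex (V.map β) := by
        rw [Subgroup.relIndex_inf_mul_relIndex, inf_of_le_left hWV]
    _ ≤ W.relIndex V * V.relIndex (V.map β) :=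
        Nat.mul_le_mul_right _ (Subgroup.relIndex_le_of_le_right inf_le_left hV)

theorem displacementIndex_le_of_ge {β : Monoid.End G} (hWV : W ≤ V) (hV : W.relIndex V ≠ 0)
    (hβ : displacementIndex β W ≠ 0) :
    displacementIndex β V ≤ W.relIndex V * displacementIndex β W := by
  have hdvd := relIndex_map_map_dvd β W V
  rw [displacementIndex_eq_relIndex] at hβ ⊢
  rw [displacementIndex_eq_relIndex]
  calc V.relIndex (V.map β) ≤ V.relIndex (W.map β) * (W.map β).relIndex (V.map β) :=
        relIndex_le_relIndex_mul_relIndex (Subgroup.map_mono hWV) (ne_zero_of_dvd_ne_zero hV hdvd)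
    _ ≤ W.relIndex (W.map β) * W.relIndex V :=
        Nat.mul_le_mul (Subgroup.relIndex_le_of_le_left hWV hβ)
          (Nat.le_of_dvd (Nat.pos_of_ne_zero hV) hdvd)
    _ = W.relIndex V * W.relIndex (W.map β) := mul_comm _ _

variable [TopologicalSpace G] [IsTopologicalGroup G]

theorem displacementIndex_le_mul_displacementIndex {β : Monoid.End G} (hβ : Continuous β)
    (hVo : IsOpen (V : Set G)) (hVc : IsCompact (V : Set G))
    (hWo : IsOpen (W : Set G)) (hWc : IsCompact (W : Set G)) :
    displacementIndex β V ≤ W.relIndex V * V.relIndex W * displacementIndex β W := by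
  have hIo : IsOpen ((V ⊓ W : Subgroup G) : Set G) := hVo.inter hWo
  have hIc : IsCompact ((V ⊓ W : Subgroup G) : Set G) :=
    hVc.inter_right (W.isClosed_of_isOpen hWo)
  calc displacementIndex β V ≤ (V ⊓ W).relIndex V * displacementIndex β (V ⊓ W) :=
        displacementIndex_le_of_ge inf_le_left (relIndex_ne_zero_of_isOpen_of_isCompact hIo hVc)
          (displacementIndex_ne_zero β hβ _ hIc hIo)
    _ ≤ (V ⊓ W).relIndex V * ((V ⊓ W).relIndex W * displacementIndex β W) :=
        Nat.mul_le_mul_left _ (displacementIndex_le_of_le inf_le_right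
          (relIndex_ne_zero_of_isOpen_of_isCompact hIo hWc)
          (displacementIndex_ne_zero β hβ _ hWc hWo))
    _ = W.relIndex V * V.relIndex W * displacementIndex β W := by
        rw [Subgroup.inf_relIndex_left, Subgroup.inf_relIndex_right, mul_assoc]

theorem displacementIndex_pow_le_pow {α : Monoid.End G} (hα : Continuous α)
    (hWo : IsOpen (W : Set G)) (hWc : IsCompact (W : Set G)) (n : ℕ) :
    displacementIndex (α ^ n) W ≤ displacementIndex α W ^ n := by
  induction n with
  | zero =>
    exact ((displacementIndex_eq_relIndex (α ^ 0) W).trans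
      ((congrArg W.relIndex (map_end_pow_zero α W)).trans W.relIndex_self)).le
  | succ n ih =>
    rw [pow_succ, pow_succ]
    exact (displacementIndex_mul_le
      (displacementIndex_ne_zero _ (continuous_end_pow hα n) W hWc hWo)
      (displacementIndex_ne_zero α hα W hWc hWo)).trans (Nat.mul_le_mul_right _ ih)

end DisplacementIndex

section Compactness

variable {G : Type*} [Group G] [TopologicalSpace G] [IsTopologicalGroup G]

theorem iInter_mul_subset_mul_iInter_of_isCompact {K : Set G} (hK : IsCompact K)
    {C : ℕ → Set G} (hC : Antitone C) (hCc : ∀ n, IsClosed (C n)) :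
    ⋂ n, K * C n ⊆ K * ⋂ n, C n := by
  intro x hx
  rw [Set.mem_iInter] at hx
  obtain ⟨p, hpK, hp⟩ : (K ∩ ⋂ n, {p | p⁻¹ * x ∈ C n}).Nonempty := by
    refine hK.inter_iInter_nonempty _
      (fun n => (hCc n).preimage (continuous_inv.mul continuous_const)) fun s => ?_
    obtain ⟨N, hN⟩ := s.bddAbove
    obtain ⟨p, hpK, c, hc, rfl⟩ := hx N
    refine ⟨p, hpK, Set.mem_iInter₂.mpr fun n hn => ?_⟩
    simpa using hC (hN hn) hc
  exact ⟨p, hpK, p⁻¹ * x, Set.mem_iInter.mpr fun n => Set.mem_iInter.mp hp n,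
    mul_inv_cancel_left p x⟩

theorem exists_isOpen_le_normalizer {U L : Subgroup G} (hU : IsOpen (U : Set G))
    (hL : IsCompact (L : Set G)) :
    ∃ V ≤ U, IsOpen (V : Set G) ∧ L ≤ Subgroup.normalizer (V : Set G) := by
  let V : Subgroup G := ⨅ l ∈ L, U.comap (MulAut.conj l).toMonoidHom
  have hV : ∀ x, x ∈ V ↔ ∀ l ∈ L, l * x * l⁻¹ ∈ U := fun x => by
    simp [V, Subgroup.mem_iInf]
  refine ⟨V, fun x hx => by simpa using (hV x).mp hx 1 L.one_mem, ?_, ?_⟩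
  · refine V.isOpen_of_mem_nhds (g := 1) ?_
    suffices ∀ᶠ x in 𝓝 (1 : G), ∀ l ∈ (L : Set G), l * x * l⁻¹ ∈ U from
      this.mono fun x hx => (hV x).mpr hx
    refine hL.eventually_forall_of_forall_eventually fun l _ => ?_
    have hcont : Continuous fun p : G × G => p.2 * p.1 * p.2⁻¹ := by fun_prop
    exact hcont.continuousAt.eventually (hU.mem_nhds (by simp [U.one_mem]))
  · refine Subgroup.le_normalizer_iff.mpr fun l hl x hx => (hV _).mpr fun k hk => ?_
    simpa [mul_assoc] using (hV x).mp hx _ (L.mul_mem hk hl)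

theorem isCompact_sup_of_le_normalizer {K L : Subgroup G} (hK : IsCompact (K : Set G))
    (hL : IsCompact (L : Set G)) (h : L ≤ Subgroup.normalizer (K : Set G)) :
    IsCompact ((K ⊔ L : Subgroup G) : Set G) := by
  rw [Subgroup.coe_mul_of_right_le_normalizer_left K L h]
  exact hK.mul hL

end Compactness

section Cores

variable {G : Type*} [Group G]

/-- The elements `x` with `x, α x, …, αⁿ x ∈ U`. -/
def finiteForwardCore (α : Monoid.End G) (U : Subgroup G) (n : ℕ) : Subgroup G :=
  ⨅ k ≤ n, U.comap (α ^ k)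

/-- The subgroup `U₋` of elements whose forward `α`-orbit stays in `U`. -/
def forwardCore (α : Monoid.End G) (U : Subgroup G) : Subgroup G :=
  ⨅ k : ℕ, U.comap (α ^ k)

/-- The subgroup `U₊` of end points of arbitrarily long finite `α`-trajectories in `U`. For `U`
compact these are the end points of infinite backward trajectories, by `backwardCore_le_map`. -/
def backwardCore (α : Monoid.End G) (U : Subgroup G) : Subgroup G :=
  ⨅ n : ℕ, (finiteForwardCore α U n).map (α ^ n)

variable {α : Monoid.End G} {U V L : Subgroup G} {n : ℕ} {x : G}

theorem mem_finiteForwardCore : x ∈ finiteForwardCore α U n ↔ ∀ k ≤ n, (α ^ k) x ∈ U := by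
  simp only [finiteForwardCore, Subgroup.mem_iInf]
  rfl

theorem mem_forwardCore : x ∈ forwardCore α U ↔ ∀ k, (α ^ k) x ∈ U := by
  simp only [forwardCore, Subgroup.mem_iInf]
  rfl

theorem mem_backwardCore :
    x ∈ backwardCore α U ↔ ∀ n, ∃ y ∈ finiteForwardCore α U n, (α ^ n) y = x := by
  simp only [backwardCore, Subgroup.mem_iInf]
  rfl

theorem antitone_finiteForwardCore : Antitone (finiteForwardCore α U) := fun _ _ h _ hx =>
  mem_finiteForwardCore.mpr fun k hk => mem_finiteForwardCore.mp hx k (hk.trans h)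

theorem finiteForwardCore_mono (h : U ≤ V) (n : ℕ) :
    finiteForwardCore α U n ≤ finiteForwardCore α V n := fun _ hx =>
  mem_finiteForwardCore.mpr fun k hk => h (mem_finiteForwardCore.mp hx k hk)

theorem finiteForwardCore_le (n : ℕ) : finiteForwardCore α U n ≤ U := fun _ hx =>
  mem_finiteForwardCore.mp hx 0 n.zero_le

theorem forwardCore_le_finiteForwardCore (n : ℕ) :
    forwardCore α U ≤ finiteForwardCore α U n := fun _ hx =>
  mem_finiteForwardCore.mpr fun k _ => mem_forwardCore.mp hx k

theorem forwardCore_le : forwardCore α U ≤ U := fun _ hx => mem_forwardCore.mp hx 0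

theorem forwardCore_mono (h : U ≤ V) : forwardCore α U ≤ forwardCore α V := fun _ hx =>
  mem_forwardCore.mpr fun k => h (mem_forwardCore.mp hx k)

theorem backwardCore_le : backwardCore α U ≤ U := fun x hx => by
  obtain ⟨y, hy, rfl⟩ := mem_backwardCore.mp hx 0
  exact finiteForwardCore_le 0 hy

theorem backwardCore_mono (h : U ≤ V) : backwardCore α U ≤ backwardCore α V :=
  iInf_mono fun n => Subgroup.map_mono (finiteForwardCore_mono h n)

theorem map_forwardCore_le : (forwardCore α U).map α ≤ forwardCore α U := by
  rintro _ ⟨x, hx, rfl⟩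
  exact mem_forwardCore.mpr fun k => end_pow_succ_apply α k x ▸ mem_forwardCore.mp hx (k + 1)

theorem map_finiteForwardCore_succ_le (n : ℕ) :
    (finiteForwardCore α U (n + 1)).map α ≤ finiteForwardCore α U n := by
  rintro _ ⟨x, hx, rfl⟩
  exact mem_finiteForwardCore.mpr fun k hk =>
    end_pow_succ_apply α k x ▸ mem_finiteForwardCore.mp hx (k + 1) (Nat.succ_le_succ hk)

theorem antitone_map_finiteForwardCore :
    Antitone fun n : ℕ => (finiteForwardCore α U n).map (α ^ n) := by
  refine antitone_nat_of_succ_le fun n => ?_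
  rw [map_end_pow_succ]
  exact Subgroup.map_mono (map_finiteForwardCore_succ_le n)

theorem le_map_finiteForwardCore_of_le_map (h : U ≤ U.map α) (n : ℕ) :
    U ≤ (finiteForwardCore α U n).map (α ^ n) := by
  induction n with
  | zero => exact fun x hx => ⟨x, mem_finiteForwardCore.mpr fun k hk => by
      rwa [Nat.le_zero.mp hk], rfl⟩
  | succ n ih =>
    rw [map_end_pow_succ]
    refine ih.trans (Subgroup.map_mono fun y hy => ?_)
    obtain ⟨z, hz, rfl⟩ := h (finiteForwardCore_le n hy)
    refine ⟨z, mem_finiteForwardCore.mpr fun k hk => ?_, rfl⟩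
    cases k with
    | zero => exact hz
    | succ k =>
      rw [end_pow_succ_apply]
      exact mem_finiteForwardCore.mp hy k (Nat.le_of_succ_le_succ hk)

theorem le_backwardCore (hVU : V ≤ U) (h : V ≤ V.map α) : V ≤ backwardCore α U :=
  le_iInf fun n => (le_map_finiteForwardCore_of_le_map h n).trans
    (Subgroup.map_mono (finiteForwardCore_mono hVU n))

theorem map_backwardCore_inf_le (h : backwardCore α U ≤ (backwardCore α U).map α) :
    (backwardCore α U).map α ⊓ U ≤ backwardCore α U := by
  refine le_backwardCore inf_le_right ?_
  rintro _ ⟨⟨z, hz, rfl⟩, -⟩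
  exact ⟨z, ⟨h hz, backwardCore_le hz⟩, rfl⟩

theorem finiteForwardCore_backwardCore_le (h : backwardCore α U ≤ (backwardCore α U).map α)
    (n : ℕ) :
    finiteForwardCore α (backwardCore α U) n ≤ backwardCore α (finiteForwardCore α U n) := by
  refine le_backwardCore (finiteForwardCore_mono backwardCore_le n) fun x hx => ?_
  obtain ⟨z, hz, rfl⟩ := h (finiteForwardCore_le n hx)
  refine ⟨z, mem_finiteForwardCore.mpr fun k hk => ?_, rfl⟩
  cases k with
  | zero => exact hz
  | succ k =>
    rw [end_pow_succ_apply]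
    exact mem_finiteForwardCore.mp hx k (Nat.le_of_succ_le hk)

theorem le_normalizer_finiteForwardCore (hL : L.map α ≤ L)
    (hU : L ≤ Subgroup.normalizer (U : Set G)) (n : ℕ) :
    L ≤ Subgroup.normalizer (finiteForwardCore α U n : Set G) := by
  refine Subgroup.le_normalizer_iff.mpr fun l hl x hx => mem_finiteForwardCore.mpr fun k hk => ?_
  rw [map_mul, map_mul, map_inv]
  exact Subgroup.le_normalizer_iff.mp hU _ (end_pow_mem_of_map_le hL k hl) _
    (mem_finiteForwardCore.mp hx k hk)

theorem le_normalizer_backwardCore (hL : L.map α = L)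
    (hU : L ≤ Subgroup.normalizer (U : Set G)) :
    L ≤ Subgroup.normalizer (backwardCore α U : Set G) := by
  refine le_trans (le_iInf fun n => ?_) (Subgroup.iInf_normalizer_le_normalizer_iInf _)
  calc L = L.map (α ^ n) := (map_end_pow_eq_self hL n).symm
    _ ≤ (Subgroup.normalizer (finiteForwardCore α U n : Set G)).map (α ^ n) :=
        Subgroup.map_mono (le_normalizer_finiteForwardCore hL.le hU n)
    _ ≤ Subgroup.normalizer ((finiteForwardCore α U n).map (α ^ n) : Set G) :=
        Subgroup.le_normalizer_map _

end Cores

section TopologicalCores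

variable {G : Type*} [Group G] [TopologicalSpace G] {α : Monoid.End G} {U : Subgroup G}

theorem isClosed_finiteForwardCore (hα : Continuous α) (hU : IsClosed (U : Set G)) (n : ℕ) :
    IsClosed (finiteForwardCore α U n : Set G) := by
  simp only [finiteForwardCore, Subgroup.coe_iInf]
  exact isClosed_biInter fun k _ => hU.preimage (continuous_end_pow hα k)

theorem isOpen_finiteForwardCore (hα : Continuous α) (hU : IsOpen (U : Set G)) (n : ℕ) :
    IsOpen (finiteForwardCore α U n : Set G) := by
  simp only [finiteForwardCore, Subgroup.coe_iInf]
  exact (Set.finite_le_nat n).isOpen_biInter fun k _ => hU.preimage (continuous_end_pow hα k)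

theorem isClosed_forwardCore (hα : Continuous α) (hU : IsClosed (U : Set G)) :
    IsClosed (forwardCore α U : Set G) := by
  simp only [forwardCore, Subgroup.coe_iInf]
  exact isClosed_iInter fun k => hU.preimage (continuous_end_pow hα k)

variable [T2Space G]

theorem isCompact_finiteForwardCore (hα : Continuous α) (hU : IsCompact (U : Set G)) (n : ℕ) :
    IsCompact (finiteForwardCore α U n : Set G) :=
  hU.of_isClosed_subset (isClosed_finiteForwardCore hα hU.isClosed n) (finiteForwardCore_le n)

theorem isCompact_forwardCore (hα : Continuous α) (hU : IsCompact (U : Set G)) :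
    IsCompact (forwardCore α U : Set G) :=
  hU.of_isClosed_subset (isClosed_forwardCore hα hU.isClosed) forwardCore_le

theorem isCompact_map_finiteForwardCore (hα : Continuous α) (hU : IsCompact (U : Set G)) (n : ℕ) :
    IsCompact ((finiteForwardCore α U n).map (α ^ n) : Set G) :=
  (isCompact_finiteForwardCore hα hU n).image (continuous_end_pow hα n)

theorem isCompact_backwardCore (hα : Continuous α) (hU : IsCompact (U : Set G)) :
    IsCompact (backwardCore α U : Set G) := by
  refine hU.of_isClosed_subset ?_ backwardCore_le
  simp only [backwardCore, Subgroup.coe_iInf]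
  exact isClosed_iInter fun n => (isCompact_map_finiteForwardCore hα hU n).isClosed

theorem backwardCore_le_map (hα : Continuous α) (hU : IsCompact (U : Set G)) :
    backwardCore α U ≤ (backwardCore α U).map α := by
  intro x hx
  have hfiber : IsClosed (α ⁻¹' {x}) := isClosed_singleton.preimage hα
  have hcompact := isCompact_map_finiteForwardCore hα hU
  obtain ⟨y, hy⟩ := IsCompact.nonempty_iInter_of_sequence_nonempty_isCompact_isClosed
    (fun n => ((finiteForwardCore α U n).map (α ^ n) : Set G) ∩ α ⁻¹' {x})
    (fun n => Set.inter_subset_inter_left _ (antitone_map_finiteForwardCore n.le_succ))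
    (fun n => by
      obtain ⟨y, hy, rfl⟩ := mem_backwardCore.mp hx (n + 1)
      exact ⟨(α ^ n) y, ⟨y, antitone_finiteForwardCore n.le_succ hy, rfl⟩,
        (end_pow_succ_apply' α n y).symm⟩)
    ((hcompact 0).inter_right hfiber) (fun n => (hcompact n).isClosed.inter hfiber)
  rw [Set.mem_iInter] at hy
  exact ⟨y, Subgroup.mem_iInf.mpr fun n => (hy n).1, (hy 0).2⟩

end TopologicalCores

section TidyAbove

variable {G : Type*} [Group G]

/-- `U` is tidy above for `α` if `U = U₊U₋`; only the nontrivial inclusion is recorded. -/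
def IsTidyAbove (α : Monoid.End G) (U : Subgroup G) : Prop :=
  (U : Set G) ⊆ (backwardCore α U : Set G) * (forwardCore α U : Set G)

variable {α : Monoid.End G} {U : Subgroup G}

theorem IsTidyAbove.sup_subset_mul {L : Subgroup G} (hU : IsTidyAbove α U)
    (hL : L ≤ Subgroup.normalizer (U : Set G)) :
    ((U ⊔ L : Subgroup G) : Set G) ⊆
      ((backwardCore α U ⊔ L : Subgroup G) : Set G) * (forwardCore α U : Set G) := by
  rw [sup_comm, Subgroup.coe_mul_of_left_le_normalizer_right L U hL]
  rintro _ ⟨l, hl, u, hu, rfl⟩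
  obtain ⟨p, hp, q, hq, rfl⟩ := hU hu
  exact ⟨l * p, mul_mem (Subgroup.mem_sup_right hl) (Subgroup.mem_sup_left hp), q, hq,
    mul_assoc l p q⟩

theorem finiteForwardCore_subset_mul_succ (h : backwardCore α U ≤ (backwardCore α U).map α) {n : ℕ}
    (hn : ((finiteForwardCore α U n).map (α ^ n) : Set G) ⊆
      (backwardCore α U : Set G) * α ⁻¹' (U : Set G)) :
    (finiteForwardCore α U n : Set G) ⊆
      (finiteForwardCore α (backwardCore α U) n : Set G) *
        (finiteForwardCore α U (n + 1) : Set G) := by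
  intro y hy
  obtain ⟨p, hp, q, hq, hpq⟩ := hn ⟨y, hy, rfl⟩
  obtain ⟨r, hr, rfl⟩ := le_map_finiteForwardCore_of_le_map h n hp
  have hry : (α ^ n) (r⁻¹ * y) = q := by
    rw [map_mul, map_inv]
    exact inv_mul_eq_of_eq_mul hpq.symm
  have hrU : r ∈ finiteForwardCore α U n := finiteForwardCore_mono backwardCore_le n hr
  refine ⟨r, hr, r⁻¹ * y, mem_finiteForwardCore.mpr fun k hk => ?_, mul_inv_cancel_left r y⟩
  rcases Nat.le_succ_iff.mp hk with hk | rfl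
  · exact mem_finiteForwardCore.mp (mul_mem (inv_mem hrU) hy) k hk
  · rw [end_pow_succ_apply', hry]
    exact hq

theorem finiteForwardCore_subset_mul_add (h : backwardCore α U ≤ (backwardCore α U).map α) {n : ℕ}
    (hn : ((finiteForwardCore α U n).map (α ^ n) : Set G) ⊆
      (backwardCore α U : Set G) * α ⁻¹' (U : Set G)) (k : ℕ) :
    (finiteForwardCore α U n : Set G) ⊆
      (backwardCore α (finiteForwardCore α U n) : Set G) *
        (finiteForwardCore α U (n + k) : Set G) := by
  induction k with
  | zero => exact fun y hy => ⟨1, one_mem _, y, hy, one_mul y⟩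
  | succ k ih =>
    intro y hy
    obtain ⟨p, hp, z, hz, rfl⟩ := ih hy
    have hnk : ((finiteForwardCore α U (n + k)).map (α ^ (n + k)) : Set G) ⊆
        (backwardCore α U : Set G) * α ⁻¹' (U : Set G) := fun x hx =>
      hn (antitone_map_finiteForwardCore (Nat.le_add_right n k) hx)
    obtain ⟨r, hr, q, hq, rfl⟩ := finiteForwardCore_subset_mul_succ h hnk hz
    have hr' := finiteForwardCore_backwardCore_le h n
      (antitone_finiteForwardCore (Nat.le_add_right n k) hr)
    exact ⟨p * r, mul_mem hp hr', q, hq, mul_assoc p r q⟩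

variable [TopologicalSpace G] [IsTopologicalGroup G] [T2Space G]

theorem exists_map_finiteForwardCore_subset_mul (hα : Continuous α) (hUo : IsOpen (U : Set G))
    (hUc : IsCompact (U : Set G)) :
    ∃ n, ((finiteForwardCore α U n).map (α ^ n) : Set G) ⊆
      (backwardCore α U : Set G) * α ⁻¹' (U : Set G) := by
  refine exists_subset_nhds_of_isCompact' antitone_map_finiteForwardCore.directed_ge
    (isCompact_map_finiteForwardCore hα hUc)
    (fun n => (isCompact_map_finiteForwardCore hα hUc n).isClosed) fun x hx => ?_
  refine (hUo.preimage hα).mul_left.mem_nhds ⟨x, ?_, 1, by simp [U.one_mem], mul_one x⟩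
  exact Subgroup.mem_iInf.mpr (Set.mem_iInter.mp hx)

theorem exists_isTidyAbove_finiteForwardCore (hα : Continuous α) (hUo : IsOpen (U : Set G))
    (hUc : IsCompact (U : Set G)) : ∃ n, IsTidyAbove α (finiteForwardCore α U n) := by
  obtain ⟨n, hn⟩ := exists_map_finiteForwardCore_subset_mul hα hUo hUc
  have hsub := finiteForwardCore_subset_mul_add (backwardCore_le_map hα hUc) hn
  have hinter := iInter_mul_subset_mul_iInter_of_isCompact
    (isCompact_backwardCore hα (isCompact_finiteForwardCore hα hUc n))
    (C := fun k => (finiteForwardCore α U (n + k) : Set G))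
    (fun _ _ hkl => antitone_finiteForwardCore (Nat.add_le_add_left hkl n))
    (fun k => isClosed_finiteForwardCore hα hUc.isClosed (n + k))
  refine ⟨n, (Set.subset_iInter hsub).trans (hinter.trans (Set.mul_subset_mul_left ?_))⟩
  refine fun q hq => mem_forwardCore.mpr fun k => mem_finiteForwardCore.mpr fun j hj => ?_
  rw [← end_pow_add_apply]
  exact mem_finiteForwardCore.mp (Set.mem_iInter.mp hq k) (j + k) (Nat.add_le_add_right hj k)

end TidyAbove

section Homoclinic

variable {G : Type*} [Group G]

/-- The elements with a backward trajectory ending in `U₊` and a forward orbit ending in `U₋`, which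
obstruct tidiness. For `U₊ ≤ α(U₊)`, as when `U` is compact, both suprema are increasing unions. -/
def homoclinicSubgroup (α : Monoid.End G) (U : Subgroup G) : Subgroup G :=
  (⨆ m : ℕ, (backwardCore α U).map (α ^ m)) ⊓ ⨆ n : ℕ, (forwardCore α U).comap (α ^ n)

variable {α : Monoid.End G} {U : Subgroup G}

theorem map_inf_comap_le_homoclinicSubgroup (m n : ℕ) :
    (backwardCore α U).map (α ^ m) ⊓ (forwardCore α U).comap (α ^ n) ≤ homoclinicSubgroup α U :=
  inf_le_inf (le_iSup (fun m : ℕ => (backwardCore α U).map (α ^ m)) m)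
    (le_iSup (fun n : ℕ => (forwardCore α U).comap (α ^ n)) n)

theorem monotone_comap_forwardCore : Monotone fun n : ℕ => (forwardCore α U).comap (α ^ n) := by
  refine monotone_nat_of_le_succ fun n x hx => ?_
  change (α ^ (n + 1)) x ∈ forwardCore α U
  rw [end_pow_succ_apply']
  exact map_forwardCore_le (Subgroup.mem_map_of_mem α hx)

theorem mem_homoclinicSubgroup (h : backwardCore α U ≤ (backwardCore α U).map α) {x : G} :
    x ∈ homoclinicSubgroup α U ↔
      (∃ m, x ∈ (backwardCore α U).map (α ^ m)) ∧ ∃ n, (α ^ n) x ∈ forwardCore α U := by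
  rw [homoclinicSubgroup, Subgroup.mem_inf,
    Subgroup.mem_iSup_of_directed (monotone_map_end_pow h).directed_le,
    Subgroup.mem_iSup_of_directed monotone_comap_forwardCore.directed_le]
  rfl

theorem map_homoclinicSubgroup (h : backwardCore α U ≤ (backwardCore α U).map α) :
    (homoclinicSubgroup α U).map α = homoclinicSubgroup α U := by
  refine le_antisymm ?_ fun x hx => ?_
  · rintro _ ⟨x, hx, rfl⟩
    obtain ⟨⟨m, y, hy, rfl⟩, n, hn⟩ := (mem_homoclinicSubgroup h).mp hx
    have hn' : (α ^ n) (α ((α ^ m) y)) ∈ forwardCore α U := by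
      rw [← end_pow_succ_apply]
      exact monotone_comap_forwardCore n.le_succ hn
    exact map_inf_comap_le_homoclinicSubgroup (m + 1) n
      ⟨⟨y, hy, end_pow_succ_apply' α m y⟩, hn'⟩
  · obtain ⟨⟨m, hm⟩, n, hn⟩ := (mem_homoclinicSubgroup h).mp hx
    obtain ⟨y, hy, rfl⟩ := monotone_map_end_pow h m.le_succ hm
    have hxy : (α ^ (m + 1)) y = α ((α ^ m) y) := end_pow_succ_apply' α m y
    have hn' : (α ^ (n + 1)) ((α ^ m) y) ∈ forwardCore α U := by
      rw [end_pow_succ_apply, ← hxy]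
      exact hn
    exact ⟨(α ^ m) y, map_inf_comap_le_homoclinicSubgroup m (n + 1) ⟨⟨y, hy, rfl⟩, hn'⟩, hxy.symm⟩

theorem map_inf_homoclinicSubgroup_subset_mul_succ
    (h : backwardCore α U ≤ (backwardCore α U).map α) {N k : ℕ} (hNk : N ≤ k)
    (hN : (((backwardCore α U).map α ⊓ homoclinicSubgroup α U : Subgroup G) : Set G) ⊆
      (backwardCore α U : Set G) *
        (homoclinicSubgroup α U ⊓ (forwardCore α U).comap (α ^ N) : Subgroup G)) :
    (((backwardCore α U).map (α ^ (k + 1)) ⊓ homoclinicSubgroup α U : Subgroup G) : Set G) ⊆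
      ((backwardCore α U).map (α ^ k) ⊓ homoclinicSubgroup α U : Subgroup G) *
        ((forwardCore α U ⊓ homoclinicSubgroup α U : Subgroup G) : Set G) := by
  have hmap := map_homoclinicSubgroup h
  rintro _ ⟨⟨y, hy, rfl⟩, hx⟩
  have hxy : (α ^ (k + 1)) y = (α ^ k) (α y) := end_pow_succ_apply α k y
  have hyL : α y ∈ homoclinicSubgroup α U := by
    obtain ⟨n, hn⟩ := ((mem_homoclinicSubgroup h).mp hx).2
    change (α ^ n) ((α ^ (k + 1)) y) ∈ _ at hn
    rw [hxy, ← end_pow_add_apply] at hn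
    exact map_inf_comap_le_homoclinicSubgroup 1 _ ⟨⟨y, hy, end_pow_succ_apply α 0 y⟩, hn⟩
  obtain ⟨a, ha, v, ⟨hvL, hv⟩, hav⟩ := hN ⟨⟨y, hy, rfl⟩, hyL⟩
  have haL : a ∈ homoclinicSubgroup α U := by
    rw [eq_mul_inv_of_mul_eq hav]
    exact mul_mem hyL (inv_mem hvL)
  refine ⟨(α ^ k) a, ⟨⟨a, ha, rfl⟩, end_pow_mem_of_map_le hmap.le k haL⟩, (α ^ k) v,
    ⟨monotone_comap_forwardCore hNk hv, end_pow_mem_of_map_le hmap.le k hvL⟩, ?_⟩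
  change (α ^ k) a * (α ^ k) v = (α ^ (k + 1)) y
  rw [hxy, ← map_mul]
  exact congrArg (α ^ k) hav

theorem exists_map_inf_homoclinicSubgroup_subset_mul
    (h : backwardCore α U ≤ (backwardCore α U).map α)
    (hfin : U.relIndex ((backwardCore α U).map α) ≠ 0) :
    ∃ N, (((backwardCore α U).map α ⊓ homoclinicSubgroup α U : Subgroup G) : Set G) ⊆
      (backwardCore α U : Set G) *
        (homoclinicSubgroup α U ⊓ (forwardCore α U).comap (α ^ N) : Subgroup G) := by
  obtain ⟨N, hN⟩ := exists_subset_mul_of_relIndex_ne_zero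
    (K := (backwardCore α U).map α ⊓ homoclinicSubgroup α U)
    (fun hzero => hfin (Subgroup.relIndex_eq_zero_of_le_right inf_le_left hzero))
    (monotone_comap_forwardCore (α := α) (U := U))
    (fun x hx => ((mem_homoclinicSubgroup h).mp hx.2).2)
  refine ⟨N, hN.trans (Set.mul_subset_mul ?_ ?_)⟩
  · exact fun x hx => map_backwardCore_inf_le h ⟨hx.2.1, hx.1⟩
  · exact fun x hx => ⟨hx.1.2, hx.2⟩

theorem exists_homoclinicSubgroup_subset_mul (h : backwardCore α U ≤ (backwardCore α U).map α)
    (hfin : U.relIndex ((backwardCore α U).map α) ≠ 0) :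
    ∃ N, (homoclinicSubgroup α U : Set G) ⊆ ((backwardCore α U).map (α ^ N) : Set G) *
      ((forwardCore α U ⊓ homoclinicSubgroup α U : Subgroup G) : Set G) := by
  obtain ⟨N, hN⟩ := exists_map_inf_homoclinicSubgroup_subset_mul h hfin
  have hstable : ∀ m, (((backwardCore α U).map (α ^ (N + m)) ⊓ homoclinicSubgroup α U :
      Subgroup G) : Set G) ⊆ ((backwardCore α U).map (α ^ N) : Set G) *
        ((forwardCore α U ⊓ homoclinicSubgroup α U : Subgroup G) : Set G) := by
    intro m
    induction m with
    | zero => exact fun x hx => ⟨x, hx.1, 1, one_mem _, mul_one x⟩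
    | succ m ih =>
      intro x hx
      obtain ⟨y, hy, v, hv, rfl⟩ :=
        map_inf_homoclinicSubgroup_subset_mul_succ h (Nat.le_add_right N m) hN hx
      obtain ⟨p, hp, u, hu, rfl⟩ := ih hy
      exact ⟨p, hp, u * v, mul_mem hu hv, (mul_assoc p u v).symm⟩
  refine ⟨N, fun x hx => ?_⟩
  obtain ⟨m, hm⟩ := ((mem_homoclinicSubgroup h).mp hx).1
  exact hstable m ⟨monotone_map_end_pow h (Nat.le_add_left m N) hm, hx⟩

end Homoclinic

section HomoclinicClosure

variable {G : Type*} [Group G] [TopologicalSpace G] [IsTopologicalGroup G] [T2Space G]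
  {α : Monoid.End G} {U : Subgroup G}

theorem exists_closure_homoclinicSubgroup_subset_mul (hα : Continuous α)
    (hUo : IsOpen (U : Set G)) (hUc : IsCompact (U : Set G)) :
    ∃ N, ((homoclinicSubgroup α U).topologicalClosure : Set G) ⊆
      ((backwardCore α U).map (α ^ N) : Set G) *
        ((forwardCore α U ⊓ (homoclinicSubgroup α U).topologicalClosure : Subgroup G) : Set G) := by
  have hP := isCompact_backwardCore hα hUc
  obtain ⟨N, hN⟩ := exists_homoclinicSubgroup_subset_mul (backwardCore_le_map hα hUc)
    (relIndex_ne_zero_of_isOpen_of_isCompact hUo (hP.image hα))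
  have hQ : IsCompact ((forwardCore α U ⊓ (homoclinicSubgroup α U).topologicalClosure :
      Subgroup G) : Set G) :=
    (isCompact_forwardCore hα hUc).inter_right (Subgroup.isClosed_topologicalClosure _)
  refine ⟨N, closure_minimal (hN.trans (Set.mul_subset_mul_left ?_))
    ((hP.image (continuous_end_pow hα N)).mul hQ).isClosed⟩
  exact inf_le_inf_left _ (Subgroup.le_topologicalClosure _)

theorem isCompact_closure_homoclinicSubgroup (hα : Continuous α) (hUo : IsOpen (U : Set G))
    (hUc : IsCompact (U : Set G)) :
    IsCompact ((homoclinicSubgroup α U).topologicalClosure : Set G) := by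
  obtain ⟨N, hN⟩ := exists_closure_homoclinicSubgroup_subset_mul hα hUo hUc
  have hP := (isCompact_backwardCore hα hUc).image (continuous_end_pow hα N)
  exact (hP.mul (isCompact_forwardCore hα hUc)).of_isClosed_subset
    (Subgroup.isClosed_topologicalClosure _)
    (hN.trans (Set.mul_subset_mul_left Set.inter_subset_left))

theorem map_closure_homoclinicSubgroup (hα : Continuous α) (hUo : IsOpen (U : Set G))
    (hUc : IsCompact (U : Set G)) :
    (homoclinicSubgroup α U).topologicalClosure.map α =
      (homoclinicSubgroup α U).topologicalClosure := by
  have hmap := map_homoclinicSubgroup (backwardCore_le_map hα hUc)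
  refine le_antisymm ?_ (Subgroup.topologicalClosure_minimal _ ?_ ?_)
  · rintro _ ⟨x, hx, rfl⟩
    exact map_mem_closure hα hx fun y hy => hmap.le (Subgroup.mem_map_of_mem α hy)
  · exact hmap.ge.trans (Subgroup.map_mono (Subgroup.le_topologicalClosure _))
  · exact ((isCompact_closure_homoclinicSubgroup hα hUo hUc).image hα).isClosed

theorem mul_mem_closure_homoclinicSubgroup (hα : Continuous α) (hUo : IsOpen (U : Set G))
    (hUc : IsCompact (U : Set G)) {m n : ℕ} {z l : G}
    (hz : z ∈ (backwardCore α U).map (α ^ m))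
    (hl : l ∈ (homoclinicSubgroup α U).topologicalClosure)
    (hzl : (α ^ n) (z * l) ∈ forwardCore α U) :
    z * l ∈ (homoclinicSubgroup α U).topologicalClosure := by
  have hB := backwardCore_le_map hα hUc
  obtain ⟨N, hN⟩ := exists_closure_homoclinicSubgroup_subset_mul hα hUo hUc
  obtain ⟨p, hp, u, ⟨huU, huL⟩, rfl⟩ := hN hl
  have hzpP : z * p ∈ (backwardCore α U).map (α ^ (m + N)) :=
    mul_mem (monotone_map_end_pow hB (Nat.le_add_right m N) hz)
      (monotone_map_end_pow hB (Nat.le_add_left N m) hp)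
  have hzpQ : (α ^ n) (z * p) ∈ forwardCore α U := by
    rw [show z * p = z * (p * u) * u⁻¹ by group, map_mul, map_inv]
    exact mul_mem hzl (inv_mem (end_pow_mem_of_map_le map_forwardCore_le n huU))
  have hzpL := map_inf_comap_le_homoclinicSubgroup _ n ⟨hzpP, hzpQ⟩
  change z * (p * u) ∈ _
  rw [← mul_assoc]
  exact mul_mem (Subgroup.le_topologicalClosure _ hzpL) huL

theorem map_end_pow_sup_closure_homoclinicSubgroup_inf_comap_le (hα : Continuous α)
    (hUo : IsOpen (U : Set G)) (hUc : IsCompact (U : Set G)) {Y : Subgroup G} (hYU : Y ≤ U)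
    (hnorm : (homoclinicSubgroup α U).topologicalClosure ≤ Subgroup.normalizer (Y : Set G))
    (m n : ℕ) :
    (backwardCore α Y ⊔ (homoclinicSubgroup α U).topologicalClosure).map (α ^ m) ⊓
        (forwardCore α Y).comap (α ^ n) ≤
      backwardCore α Y ⊔ (homoclinicSubgroup α U).topologicalClosure := by
  have hLα := map_closure_homoclinicSubgroup hα hUo hUc
  have hmul := Subgroup.coe_mul_of_right_le_normalizer_left _ _
    (le_normalizer_backwardCore hLα hnorm)
  rintro _ ⟨⟨t, ht, rfl⟩, hn⟩
  obtain ⟨y, hy, l, hl, rfl⟩ := hmul.subset ht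
  have hyl : (α ^ m) (y * l) = (α ^ m) y * (α ^ m) l := map_mul (α ^ m) y l
  have hnU : (α ^ n) ((α ^ m) y * (α ^ m) l) ∈ forwardCore α U :=
    hyl ▸ forwardCore_mono hYU hn
  refine Subgroup.mem_sup_right (hyl.symm ▸ ?_)
  exact mul_mem_closure_homoclinicSubgroup hα hUo hUc ⟨y, backwardCore_mono hYU hy, rfl⟩
    (end_pow_mem_of_map_le hLα.le m hl) hnU

end HomoclinicClosure

section Factorization

variable {G : Type*} [Group G] {α : Monoid.End G} {T Q W : Subgroup G}

theorem map_end_pow_inf_le (hT : T ≤ T.map α) (hmul : (W : Set G) ⊆ (T : Set G) * (Q : Set G))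
    (hTQ : ∀ m, T.map (α ^ m) ⊓ Q ≤ T) (m : ℕ) : T.map (α ^ m) ⊓ W ≤ T := by
  rintro x ⟨hx, hxW⟩
  obtain ⟨t, ht, q, hq, rfl⟩ := hmul hxW
  have hqm : q ∈ T.map (α ^ m) := by
    rw [← inv_mul_cancel_left t q]
    exact mul_mem (inv_mem (le_map_end_pow hT m ht)) hx
  exact mul_mem ht (hTQ m ⟨hqm, hq⟩)

theorem map_end_pow_inf_comap_le (hT : T ≤ T.map α)
    (hmul : (W : Set G) ⊆ (T : Set G) * (Q : Set G))
    (hTQ : ∀ m n, T.map (α ^ m) ⊓ Q.comap (α ^ n) ≤ T) (m n : ℕ) :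
    T.map (α ^ m) ⊓ W.comap (α ^ n) ≤ T := by
  rintro x ⟨hx, hxW⟩
  have hnx : (α ^ n) x ∈ T := by
    refine map_end_pow_inf_le hT hmul (fun m => hTQ m 0) (n + m) ⟨?_, hxW⟩
    rw [map_end_pow_add]
    exact Subgroup.mem_map_of_mem (α ^ n) hx
  obtain ⟨t, ht, htx⟩ := le_map_end_pow hT n hnx
  have htker : (α ^ n) (x * t⁻¹) = 1 := by
    rw [map_mul, map_inv, mul_inv_eq_one]
    exact htx.symm
  have hxt : x * t⁻¹ ∈ T := hTQ m n
    ⟨Subgroup.mul_mem _ hx (Subgroup.inv_mem _ (le_map_end_pow hT m ht)),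
      (congrArg (· ∈ Q) htker).mpr Q.one_mem⟩
  simpa using mul_mem hxt ht

theorem displacementIndex_pow_of_subset_mul (hTW : T ≤ W) (hQW : Q ≤ W) (hT : T ≤ T.map α)
    (hQ : Q.map α ≤ Q) (hmul : (W : Set G) ⊆ (T : Set G) * (Q : Set G))
    (hTQ : ∀ m n, T.map (α ^ m) ⊓ Q.comap (α ^ n) ≤ T) (n : ℕ) :
    displacementIndex (α ^ n) W = displacementIndex α W ^ n := by
  have hindex : ∀ n, displacementIndex (α ^ n) W = T.relIndex (T.map (α ^ n)) := fun n => by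
    have hmap : (W.map (α ^ n) : Set G) ⊆ (T.map (α ^ n) : Set G) * (W : Set G) := by
      rintro _ ⟨w, hw, rfl⟩
      obtain ⟨t, ht, q, hq, rfl⟩ := hmul hw
      exact ⟨_, ⟨t, ht, rfl⟩, (α ^ n) q, hQW (end_pow_mem_of_map_le hQ n hq),
        (map_mul (α ^ n) t q).symm⟩
    have hinf : W ⊓ T.map (α ^ n) = T :=
      le_antisymm (inf_comm W _ ▸ map_end_pow_inf_le hT hmul (fun m => hTQ m 0) n)
        (le_inf hTW (le_map_end_pow hT n))
    rw [displacementIndex_eq_relIndex, relIndex_eq_of_subset_mul (Subgroup.map_mono hTW) hmap,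
      ← Subgroup.inf_relIndex_right, hinf]
    rfl
  have hker : ∀ n, (α ^ n).ker ⊓ T.map α ≤ T := by
    rintro n x ⟨hx1, hx⟩
    refine hTQ 1 n ⟨(map_end_pow_one α T).ge hx, ?_⟩
    exact (congrArg (· ∈ Q) (MonoidHom.mem_ker.mp hx1)).mpr Q.one_mem
  have hone : displacementIndex α W = T.relIndex (T.map α) :=
    (congrArg (displacementIndex · W) (pow_one α)).symm.trans
      ((hindex 1).trans (congrArg T.relIndex (map_end_pow_one α T)))
  rw [hone]
  exact (hindex n).trans (relIndex_map_end_pow hT hker n)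

theorem backwardCore_le_of_subset_mul [TopologicalSpace G] [IsTopologicalGroup G] [T2Space G]
    (hα : Continuous α) {Y : Subgroup G} (hYc : IsCompact (Y : Set G))
    (hTc : IsCompact (T : Set G)) (hYW : Y ≤ W) (hYT : backwardCore α Y ≤ T)
    (hmul : (W : Set G) ⊆ (T : Set G) * (forwardCore α Y : Set G))
    (hTW : ∀ m, T.map (α ^ m) ⊓ W ≤ T) : backwardCore α W ≤ T := by
  have hQW : ∀ {k q}, q ∈ forwardCore α Y → (α ^ k) q ∈ W := fun hq =>
    hYW (mem_forwardCore.mp hq _)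
  have hmem : ∀ n, (backwardCore α W : Set G) ⊆
      (T : Set G) * ((forwardCore α Y).map (α ^ n) : Set G) := by
    intro n w hw
    obtain ⟨v, hv, rfl⟩ := mem_backwardCore.mp hw n
    obtain ⟨t, ht, q, hq, rfl⟩ := hmul (finiteForwardCore_le n hv)
    have hvn : (α ^ n) t * (α ^ n) q ∈ W :=
      map_mul (α ^ n) t q ▸ mem_finiteForwardCore.mp hv n le_rfl
    exact ⟨(α ^ n) t, hTW n ⟨⟨t, ht, rfl⟩, (mul_mem_cancel_right (hQW hq)).mp hvn⟩, (α ^ n) q,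
      ⟨q, hq, rfl⟩, (map_mul (α ^ n) t q).symm⟩
  have hinter := iInter_mul_subset_mul_iInter_of_isCompact hTc
    (C := fun n => ((forwardCore α Y).map (α ^ n) : Set G))
    (antitone_nat_of_succ_le fun n => by
      rw [map_end_pow_succ]
      exact Subgroup.map_mono map_forwardCore_le)
    (fun n => ((isCompact_forwardCore hα hYc).image (continuous_end_pow hα n)).isClosed)
  intro w hw
  obtain ⟨t, ht, q, hq, rfl⟩ := hinter (Set.mem_iInter.mpr fun n => hmem n hw)
  have hqY : q ∈ backwardCore α Y := Subgroup.mem_iInf.mpr fun n =>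
    Subgroup.map_mono (forwardCore_le_finiteForwardCore n) (Set.mem_iInter.mp hq n)
  exact mul_mem ht (hYT hqY)

end Factorization

section Tidy

variable {G : Type*} [Group G]

/-- `U` is tidy for `α` if `U = U₊U₋` and `U` contains its homoclinic subgroup. The second condition
is the form of tidiness below that does not mention closedness of `⋃ αⁿ(U₊)`. -/
structure IsTidy (α : Monoid.End G) (U : Subgroup G) : Prop where
  isTidyAbove : IsTidyAbove α U
  homoclinicSubgroup_le : homoclinicSubgroup α U ≤ U

variable {α : Monoid.End G} {U W : Subgroup G}

theorem IsTidy.displacementIndex_pow (hW : IsTidy α W)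
    (h : backwardCore α W ≤ (backwardCore α W).map α) (n : ℕ) :
    displacementIndex (α ^ n) W = displacementIndex α W ^ n := by
  have hL : homoclinicSubgroup α W ≤ backwardCore α W :=
    le_backwardCore hW.homoclinicSubgroup_le (map_homoclinicSubgroup h).ge
  exact displacementIndex_pow_of_subset_mul backwardCore_le forwardCore_le h map_forwardCore_le
    hW.isTidyAbove (fun m n => (map_inf_comap_le_homoclinicSubgroup m n).trans hL) n

variable [TopologicalSpace G] [IsTopologicalGroup G] [T2Space G]

theorem IsTidyAbove.isTidy_sup (hα : Continuous α) (hUo : IsOpen (U : Set G))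
    (hUc : IsCompact (U : Set G)) {Y : Subgroup G} (hY : IsTidyAbove α Y) (hYU : Y ≤ U)
    (hYc : IsCompact (Y : Set G))
    (hnorm : (homoclinicSubgroup α U).topologicalClosure ≤ Subgroup.normalizer (Y : Set G)) :
    IsTidy α (Y ⊔ (homoclinicSubgroup α U).topologicalClosure) := by
  have hLc := isCompact_closure_homoclinicSubgroup hα hUo hUc
  have hLα := map_closure_homoclinicSubgroup hα hUo hUc
  have hTQ := map_end_pow_sup_closure_homoclinicSubgroup_inf_comap_le hα hUo hUc hYU hnorm
  generalize (homoclinicSubgroup α U).topologicalClosure = L at hnorm hLc hLα hTQ ⊢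
  have hWc := isCompact_sup_of_le_normalizer hYc hLc hnorm
  have hTc := isCompact_sup_of_le_normalizer (isCompact_backwardCore hα hYc) hLc
    (le_normalizer_backwardCore hLα hnorm)
  have hTα : backwardCore α Y ⊔ L ≤ (backwardCore α Y ⊔ L).map α :=
    sup_le ((backwardCore_le_map hα hYc).trans (Subgroup.map_mono le_sup_left))
      (hLα.ge.trans (Subgroup.map_mono le_sup_right))
  have hTW : backwardCore α Y ⊔ L ≤ Y ⊔ L := sup_le_sup_right backwardCore_le L
  have hmul := hY.sup_subset_mul hnorm
  have hWT : backwardCore α (Y ⊔ L) ≤ backwardCore α Y ⊔ L :=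
    backwardCore_le_of_subset_mul hα hYc hTc le_sup_left le_sup_left hmul
      (map_end_pow_inf_le hTα hmul fun m => hTQ m 0)
  refine ⟨hmul.trans (Set.mul_subset_mul (le_backwardCore hTW hTα) (forwardCore_mono le_sup_left)),
    fun x hx => hTW ?_⟩
  obtain ⟨⟨m, hm⟩, n, hn⟩ := (mem_homoclinicSubgroup (backwardCore_le_map hα hWc)).mp hx
  have hxT : x ∈ (backwardCore α Y ⊔ L).map (α ^ m) := Subgroup.map_mono hWT hm
  have hxW : (α ^ n) x ∈ Y ⊔ L := forwardCore_le hn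
  exact map_end_pow_inf_comap_le hTα hmul hTQ m n ⟨hxT, hxW⟩

theorem exists_isTidy (hα : Continuous α) (hUo : IsOpen (U : Set G))
    (hUc : IsCompact (U : Set G)) :
    ∃ W : Subgroup G, IsOpen (W : Set G) ∧ IsCompact (W : Set G) ∧ IsTidy α W := by
  have hLc := isCompact_closure_homoclinicSubgroup hα hUo hUc
  have hLα := map_closure_homoclinicSubgroup hα hUo hUc
  obtain ⟨V, hVU, hVo, hVnorm⟩ := exists_isOpen_le_normalizer hUo hLc
  have hVc := hUc.of_isClosed_subset (V.isClosed_of_isOpen hVo) hVU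
  obtain ⟨n, hn⟩ := exists_isTidyAbove_finiteForwardCore hα hVo hVc
  have hnorm := le_normalizer_finiteForwardCore hLα.le hVnorm n
  have hYc := isCompact_finiteForwardCore hα hVc n
  exact ⟨_, Subgroup.isOpen_mono le_sup_left (isOpen_finiteForwardCore hα hVo n),
    isCompact_sup_of_le_normalizer hYc hLc hnorm,
    hn.isTidy_sup hα hUo hUc ((finiteForwardCore_le n).trans hVU) hYc hnorm⟩

end Tidy

section Limit

theorem tendsto_rpow_one_div_of_mul_pow_le_of_le_mul_pow {a : ℕ → ℝ} {c C s : ℝ} (hc : 0 < c)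
    (hs : 0 ≤ s) (hl : ∀ n, c * s ^ n ≤ a n) (hu : ∀ n, a n ≤ C * s ^ n) :
    Tendsto (fun n : ℕ => a n ^ (1 / (n : ℝ))) atTop (𝓝 s) := by
  have hC : 0 < C := hc.trans_le (by simpa using (hl 0).trans (hu 0))
  have hlim : ∀ {b : ℝ}, 0 < b →
      Tendsto (fun n : ℕ => (b * s ^ n) ^ (1 / (n : ℝ))) atTop (𝓝 s) := by
    intro b hb
    have hroot : Tendsto (fun n : ℕ => b ^ (1 / (n : ℝ)) * s) atTop (𝓝 (b ^ (0 : ℝ) * s)) :=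
      ((Real.continuousAt_const_rpow hb.ne').tendsto.comp
        tendsto_one_div_atTop_nhds_zero_nat).mul_const s
    rw [Real.rpow_zero, one_mul] at hroot
    refine hroot.congr' ?_
    filter_upwards [eventually_ne_atTop 0] with n hn
    rw [Real.mul_rpow hb.le (pow_nonneg hs n), one_div, Real.pow_rpow_inv_natCast hs hn]
  refine tendsto_of_tendsto_of_tendsto_of_le_of_le (hlim hc) (hlim hC) (fun n => ?_) fun n => ?_
  · exact Real.rpow_le_rpow (by positivity) (hl n) (by positivity)
  · exact Real.rpow_le_rpow (le_trans (by positivity) (hl n)) (hu n) (by positivity)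

variable {G : Type*} [Group G] [TopologicalSpace G] [IsTopologicalGroup G] [T2Space G]
  {α : Monoid.End G} {V W : Subgroup G}

theorem IsTidy.tendsto_displacementIndex_pow (hW : IsTidy α W) (hα : Continuous α)
    (hWo : IsOpen (W : Set G)) (hWc : IsCompact (W : Set G))
    (hVo : IsOpen (V : Set G)) (hVc : IsCompact (V : Set G)) :
    Tendsto (fun n : ℕ => (displacementIndex (α ^ n) V : ℝ) ^ (1 / (n : ℝ))) atTop
      (𝓝 (displacementIndex α W : ℝ)) := by
  have hpow := hW.displacementIndex_pow (backwardCore_le_map hα hWc)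
  have hpos : 0 < W.relIndex V * V.relIndex W := Nat.pos_of_ne_zero
    (mul_ne_zero (relIndex_ne_zero_of_isOpen_of_isCompact hWo hVc)
      (relIndex_ne_zero_of_isOpen_of_isCompact hVo hWc))
  have hC : (0 : ℝ) < (W.relIndex V * V.relIndex W : ℕ) := Nat.cast_pos.mpr hpos
  refine tendsto_rpow_one_div_of_mul_pow_le_of_le_mul_pow (inv_pos.mpr hC)
    (C := (W.relIndex V * V.relIndex W : ℕ)) (Nat.cast_nonneg _) (fun n => ?_) fun n => ?_
  · have hle := displacementIndex_le_mul_displacementIndex (continuous_end_pow hα n) hWo hWc hVo hVc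
    rw [hpow, mul_comm (V.relIndex W)] at hle
    rw [inv_mul_le_iff₀ hC]
    exact_mod_cast hle
  · have hle := displacementIndex_le_mul_displacementIndex (continuous_end_pow hα n) hVo hVc hWo hWc
    rw [hpow] at hle
    exact_mod_cast hle

theorem IsTidy.displacementIndex_eq_scale (hW : IsTidy α W) (hα : Continuous α)
    (hWo : IsOpen (W : Set G)) (hWc : IsCompact (W : Set G)) :
    displacementIndex α W = scale α := by
  have hmem : displacementIndex α W ∈ displacementIndices α := ⟨W, hWc, hWo, rfl⟩
  refine le_antisymm (le_csInf ⟨_, hmem⟩ ?_) (Nat.sInf_le hmem)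
  rintro _ ⟨U, hUc, hUo, rfl⟩
  suffices (displacementIndex α W : ℝ) ≤ displacementIndex α U from Nat.cast_le.mp this
  refine le_of_tendsto (hW.tendsto_displacementIndex_pow hα hWo hWc hUo hUc) ?_
  filter_upwards [eventually_ne_atTop 0] with n hn
  calc (displacementIndex (α ^ n) U : ℝ) ^ (1 / (n : ℝ))
      ≤ ((displacementIndex α U : ℝ) ^ n) ^ (1 / (n : ℝ)) :=
        Real.rpow_le_rpow (Nat.cast_nonneg _)
          (mod_cast displacementIndex_pow_le_pow hα hUo hUc n) (by positivity)
    _ = displacementIndex α U := by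
        rw [one_div, Real.pow_rpow_inv_natCast (Nat.cast_nonneg _) hn]

end Limit

theorem mainTheorem4_general {G : Type*} [Group G] [TopologicalSpace G] [IsTopologicalGroup G]
    [T2Space G] (α : Monoid.End G) (hα : Continuous α)
    (V : Subgroup G) (hVc : IsCompact (V : Set G)) (hVo : IsOpen (V : Set G)) :
    Tendsto (fun n : ℕ => (displacementIndex (α ^ n) V : ℝ) ^ (1 / (n : ℝ))) atTop
      (𝓝 (scale α : ℝ)) := by
  obtain ⟨W, hWo, hWc, hW⟩ := exists_isTidy hα hVo hVc
  rw [← hW.displacementIndex_eq_scale hα hWo hWc]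
  exact hW.tendsto_displacementIndex_pow hα hWo hWc hVo hVc

theorem mainTheorem4 {G : Type*} [Group G] [TopologicalSpace G] [IsTopologicalGroup G]
    [LocallyCompactSpace G] [TotallyDisconnectedSpace G]
    (α : Monoid.End G) (hα : Continuous α)
    (V : Subgroup G) (hVc : IsCompact (V : Set G)) (hVo : IsOpen (V : Set G)) :
    Tendsto (fun n : ℕ => (displacementIndex (α ^ n) V : ℝ) ^ (1 / (n : ℝ))) atTop
      (𝓝 (scale α : ℝ)) :=
  mainTheorem4_general α hα V hVc hVo
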